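/- Setting. Let $d\ge 1$ and $\mathcal A=\{1,\dots,d\}$. For a base policy $\pi_0$ (a probability vector on $\mathcal A$) and $\theta\in\mathbb R^d$ let $\pi_\theta(a)\propto\pi_0(a)e^{\theta_a}$, the linear softmax policy with features $\phi(a)=e_a$. For a policy $\pi$ let $\mathbb V(\pi)$ be the covariance matrix of $e_a$ for $a\sim\pi$, and let $C_{\pi\to\pi'}=\inf\{C>0:\mathbb V(\pi')\preceq C\,\mathbb V(\pi)\}$. Let $B_p(\theta,r)$ be the closed $L^p$-ball, and define the local $L^p$-coverage of the target $\pi_{\theta^*}$ by $C^p_{\theta^*}(R)=\sup\{C_{\pi_\theta\to\pi_{\theta^*}}:\theta\in B_p(\theta^*,R)\}$. For a temperature $\gamma>0$ and a parameter $\theta^*$, a dataset $D$ consists of $n$ i.i.d. triples $(a^1,a^2,y)$ with $a^1,a^2\sim\pi_0$ independent and Bradley–Terry labels: $a^1$ is preferred to $a^2$ with probability $\sigma(r^*(a^1)-r^*(a^2))$, where $r^*(a)=\gamma\theta^*_a$ and $\sigma(z)=1/(1+e^{-z})$. Write $\mathbb E_{\theta^*}$ for the expectation over $D$. A set $\Theta^*$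 is called a near-uniform class in $B_p(0,R)$ if $\Theta^*=B_p(\varphi,1)\subseteq B_p(0,R)$ for some $\varphi$ such that $\pi_\varphi$ is the uniform distribution on $\mathcal A$. Theorem. For every $\gamma_0>0$ there is a constant $c>0$, depending only on $\gamma_0$, such that the following holds for all $d\ge1$ and $R\ge1$. (i) There are a base policy $\pi_0$ and a near-uniform class $\Theta^*$ in $B_1(0,R)$ such that for all $\gamma\in(0,\gamma_0]$, all $n\ge1$ and all $\theta_1\in\Theta^*$, $$\inf_{\hat\theta}\sup_{\theta^*\in\Theta^*}\mathbb E_{\theta^*}\|\hat\theta(D)-\theta^*\|_1\ \ge\ c\left(d\sqrt{\frac{C^1_{\theta_1}(R)}{n}}\wedge 1\right),$$ $$\inf_{\hat\theta}\sup_{\theta^*\in\Theta^*}\mathbb E_{\theta^*}\,\mathrm{KL}\big(\pi_{\theta^*}\,\|\,\pi_{\hat\theta(D)}\big)\ \ge\ c\left(\frac{C^1_{\theta_1}(R)}{n}\wedge\frac1{d^2}\right).$$ (ii) For every $p\in(1,\infty]$ there are a base policy $\pi_0$ and a near-uniform class $\Theta^*$ in $B_p(0,R)$ such that for all $\gamma\in(0,\gamma_0]$,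 all $n\ge1$ and all $\theta_1\in\Theta^*$, $$\inf_{\hat\theta}\sup_{\theta^*\in\Theta^*}\mathbb E_{\theta^*}\|\hat\theta(D)-\theta^*\|_p\ \ge\ c\left(\sqrt{\frac{d\,C^p_{\theta_1}(R)}{n}}\wedge 1\right).$$ The infima are over all estimators, that is, all functions $\hat\theta$ from datasets to $\mathbb R^d$. -/

import Mathlib

open scoped ENNReal

namespace OfflinePref

noncomputable section

/-- The `L^p` norm on `ℝ^d`, for `1 ≤ p ≤ ∞`. -/
def vecNorm {d : ℕ} (p : ℝ≥0∞) (x : Fin d → ℝ) : ℝ :=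
  ‖(WithLp.toLp p x : PiLp p (fun _ : Fin d => ℝ))‖

/-- The closed `L^p` ball of radius `r` about `x`. -/
def lpBall {d : ℕ} (p : ℝ≥0∞) (x : Fin d → ℝ) (r : ℝ) : Set (Fin d → ℝ) :=
  {θ | vecNorm p (θ - x) ≤ r}

/-- The bandit features: the `a`-th standard basis vector. -/
def feature {d : ℕ} (a : Fin d) : Fin d → ℝ := Pi.single a 1

/-- The linear softmax policy, proportional to `π₀ a * exp ⟨θ, feature a⟩`. -/
def policy {d : ℕ} (π₀ θ : Fin d → ℝ) (a : Fin d) : ℝ :=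
  π₀ a * Real.exp (θ ⬝ᵥ feature a) / ∑ b, π₀ b * Real.exp (θ ⬝ᵥ feature b)

/-- The mean feature under a policy. -/
def meanFeature {d : ℕ} (π : Fin d → ℝ) : Fin d → ℝ := ∑ a, π a • feature a

/-- The feature covariance matrix of a policy. -/
def featureCov {d : ℕ} (π : Fin d → ℝ) : Matrix (Fin d) (Fin d) ℝ :=
  ∑ a, π a • Matrix.vecMulVec (feature a - meanFeature π) (feature a - meanFeature π)

/-- The coverage of `π'` by `π`: the infimum of all `C > 0` such that
`C • featureCov π - featureCov π'` is positive semidefinite (`∞` if there is none). -/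
def coverage {d : ℕ} (π π' : Fin d → ℝ) : ℝ≥0∞ :=
  ⨅ (C : ℝ) (_ : 0 < C) (_ : (C • featureCov π - featureCov π').PosSemidef), ENNReal.ofReal C

/-- The local `L^p` coverage, with radius `r`, of the target policy with parameter `θs`. -/
def localCoverage {d : ℕ} (p : ℝ≥0∞) (π₀ θs : Fin d → ℝ) (r : ℝ) : ℝ≥0∞ :=
  ⨆ θ ∈ lpBall p θs r, coverage (policy π₀ θ) (policy π₀ θs)

/-- The Bradley-Terry probability that `a` is preferred to `b` under the reward `rew`. -/
def prefProb {d : ℕ} (rew : Fin d → ℝ) (a b : Fin d) : ℝ := Real.sigmoid (rew a - rew b)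

/-- A dataset of `n` labeled pairs; the label is `true` if the first action is preferred. -/
abbrev Dataset (d n : ℕ) : Type := Fin n → Fin d × Fin d × Bool

/-- The probability of a labeled pair: both actions are drawn independently from `π₀`,
then the label is drawn from the Bradley-Terry model. -/
def sampleProb {d : ℕ} (π₀ rew : Fin d → ℝ) (s : Fin d × Fin d × Bool) : ℝ :=
  π₀ s.1 * π₀ s.2.1 * (if s.2.2 then prefProb rew s.1 s.2.1 else 1 - prefProb rew s.1 s.2.1)

/-- The expectation of `f D`, where `D` consists of `n` i.i.d. labeled pairs. -/
def expect {d n : ℕ} (π₀ rew : Fin d → ℝ) (f : Dataset d n → ℝ) : ℝ :=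
  ∑ D : Dataset d n, (∏ i, sampleProb π₀ rew (D i)) * f D

/-- The Kullback-Leibler divergence of probability vectors, for `π'` of full support. -/
def klDivergence {d : ℕ} (π π' : Fin d → ℝ) : ℝ := ∑ a, π a * Real.log (π a / π' a)

/-- The minimax risk over all estimators of the parameter from `n` labeled pairs. The true
parameter `θs` ranges over `Θ`; its reward function is `a ↦ γ * ⟨θs, feature a⟩`, the reward
(up to a constant) for which the maximiser of the expected reward minus `γ` times the divergence
from `π₀` is `policy π₀ θs`. -/
def minimaxRisk {d : ℕ} (n : ℕ) (γ : ℝ) (π₀ : Fin d → ℝ) (Θ : Set (Fin d → ℝ))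
    (loss : (Fin d → ℝ) → (Fin d → ℝ) → ℝ) : ℝ≥0∞ :=
  ⨅ est : Dataset d n → (Fin d → ℝ), ⨆ θs ∈ Θ,
    ENNReal.ofReal (expect π₀ (fun a => γ * (θs ⬝ᵥ feature a)) fun D => loss (est D) θs)

/-- `Θ` is a near-uniform class in the `L^p` ball of radius `R`, for the base policy `π₀`:
the closed unit `L^p` ball about a parameter whose policy is the uniform distribution. -/
def IsNearUniformClass {d : ℕ} (p : ℝ≥0∞) (R : ℝ) (π₀ : Fin d → ℝ) (Θ : Set (Fin d → ℝ)) : Prop :=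
  Θ ⊆ lpBall p 0 R ∧
    ∃ φ : Fin d → ℝ, (∀ a, policy π₀ φ a = 1 / (d : ℝ)) ∧ Θ = lpBall p φ 1

end

end OfflinePref

/-! An action that `π₀` rarely plays yields few informative comparisons, yet every policy in the
class plays it with probability of order `1 / d`. Changing the parameter at one action `b` by `2 *
δ` moves the law of a labeled pair by squared Hellinger distance at most `16 * γ ^ 2 * δ ^ 2 * π₀
b`, so shifts with `δ ^ 2` of order `1 / (n * π₀ b)` go unnoticed. Assouad's lemma
(`assouad_le_minimaxRisk`) turns this into a risk bound.

With `π₀ = softmax (-φ)` the policy of `θ` is `softmax (θ - φ)`, which is uniform at `φ`. On the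
unit ball about `φ`, the local coverage is at most `exp 2` times the largest ratio of the uniform
policy to `softmax x` over `vecNorm p x ≤ R` (`localCoverage_le`). It remains to choose `φ` so that
`π₀` has actions about as rare as this ratio permits.

For `p = 1` the ratio is at most `exp R`, and one heavy action makes the other `d - 1` all have
probability at most `exp (1 - R)`. A cube in those coordinates gives loss `d * δ` in `L¹` and `δ ^
2` in divergence, up to constants. For general `p`, a nearly extremal tilt `x` makes one action have
probability `1 / (d * M)`, where `M` is within a factor 2 of the largest ratio; perturbing that
coordinate alone suffices. -/

namespace OfflinePref

/-! ### Testing two product distributions -/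

/-- The total mass of the pointwise minimum of two distributions is at least half the square of
their affinity. -/
theorem half_sq_affinity_le_sum_min {ι : Type*} [Fintype ι] {p q : ι → ℝ} (hp : ∀ i, 0 ≤ p i)
    (hq : ∀ i, 0 ≤ q i) (hp1 : ∑ i, p i = 1) (hq1 : ∑ i, q i = 1) :
    (∑ i, √(p i * q i)) ^ 2 / 2 ≤ ∑ i, min (p i) (q i) := by
  -- Cauchy–Schwarz applied to `p * q = min * max`.
  have h1 : (∑ i, √(p i * q i)) ^ 2 ≤ (∑ i, min (p i) (q i)) * ∑ i, max (p i) (q i) := by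
    refine Finset.sum_sq_le_sum_mul_sum_of_sq_le_mul _ (fun i _ => le_min (hp i) (hq i))
      (fun i _ => le_max_of_le_left (hp i)) fun i _ => ?_
    rw [Real.sq_sqrt (mul_nonneg (hp i) (hq i)), min_mul_max]
  have h2 : ∑ i, max (p i) (q i) ≤ 2 := by
    calc ∑ i, max (p i) (q i) ≤ ∑ i, (p i + q i) := Finset.sum_le_sum fun i _ =>
          max_le (le_add_of_nonneg_right (hq i)) (le_add_of_nonneg_left (hp i))
      _ = 2 := by rw [Finset.sum_add_distrib, hp1, hq1]; norm_num
  have h3 : 0 ≤ ∑ i, min (p i) (q i) := Finset.sum_nonneg fun i _ => le_min (hp i) (hq i)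
  nlinarith

/-- The affinity of two distributions in terms of their squared Hellinger distance. -/
theorem affinity_eq {ι : Type*} [Fintype ι] {p q : ι → ℝ} (hp : ∀ i, 0 ≤ p i)
    (hq : ∀ i, 0 ≤ q i) (hp1 : ∑ i, p i = 1) (hq1 : ∑ i, q i = 1) :
    ∑ i, √(p i * q i) = 1 - (∑ i, (√(p i) - √(q i)) ^ 2) / 2 := by
  have h : ∀ i, (√(p i) - √(q i)) ^ 2 = p i + q i - 2 * √(p i * q i) := fun i => by
    rw [Real.sqrt_mul (hp i), sub_sq, Real.sq_sqrt (hp i), Real.sq_sqrt (hq i)]; ring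
  simp_rw [h]
  rw [Finset.sum_sub_distrib, Finset.sum_add_distrib, hp1, hq1, ← Finset.mul_sum]; ring

/-- The affinity is multiplicative over products. -/
theorem affinity_prod {ι : Type*} [Fintype ι] {p q : ι → ℝ} (hp : ∀ i, 0 ≤ p i)
    (hq : ∀ i, 0 ≤ q i) (n : ℕ) :
    ∑ D : Fin n → ι, √((∏ i, p (D i)) * ∏ i, q (D i)) = (∑ i, √(p i * q i)) ^ n := by
  classical
  have h : ∀ D : Fin n → ι,
      √((∏ i, p (D i)) * ∏ i, q (D i)) = ∏ i, √(p (D i) * q (D i)) := fun D => by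
    rw [← Finset.prod_mul_distrib, Real.sqrt_prod _ fun i _ => mul_nonneg (hp _) (hq _)]
  simp_rw [h]
  have := Finset.prod_univ_sum (fun _ : Fin n => (Finset.univ : Finset ι))
    fun _ s => √(p s * q s)
  simpa using this.symm

theorem sum_prod_eq_one {ι : Type*} [Fintype ι] {p : ι → ℝ} (hp1 : ∑ i, p i = 1) (n : ℕ) :
    ∑ D : Fin n → ι, ∏ i, p (D i) = 1 := by
  classical
  have := Finset.prod_univ_sum (fun _ : Fin n => (Finset.univ : Finset ι)) fun _ s => p s
  simpa [hp1] using this.symm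

/-- Two `n`-fold product distributions whose factors are within squared Hellinger distance `1 / n`
cannot be told apart. -/
theorem eighth_le_sum_min_prod {ι : Type*} [Fintype ι] {p q : ι → ℝ} (hp : ∀ i, 0 ≤ p i)
    (hq : ∀ i, 0 ≤ q i) (hp1 : ∑ i, p i = 1) (hq1 : ∑ i, q i = 1) (n : ℕ)
    (h : n * ∑ i, (√(p i) - √(q i)) ^ 2 ≤ 1) :
    1 / 8 ≤ ∑ D : Fin n → ι, min (∏ i, p (D i)) (∏ i, q (D i)) := by
  have h1 := half_sq_affinity_le_sum_min (ι := Fin n → ι) (p := fun D => ∏ i, p (D i))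
    (q := fun D => ∏ i, q (D i)) (fun D => Finset.prod_nonneg fun i _ => hp _)
    (fun D => Finset.prod_nonneg fun i _ => hq _) (sum_prod_eq_one hp1 n) (sum_prod_eq_one hq1 n)
  rw [affinity_prod hp hq] at h1
  have h0 : 0 ≤ ∑ i, √(p i * q i) := Finset.sum_nonneg fun i _ => Real.sqrt_nonneg _
  -- Bernoulli's inequality: the product affinity is at least `1 - 1 / 2`, and `(1 / 2) ^ 2 / 2 = 1
  -- / 8`.
  have h2 : 1 + n * (∑ i, √(p i * q i) - 1) ≤ (∑ i, √(p i * q i)) ^ n := by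
    have := one_add_mul_le_pow (a := ∑ i, √(p i * q i) - 1) (by linarith) n
    simpa using this
  rw [affinity_eq hp hq hp1 hq1] at h1 h2
  have h3 : 1 / 2 ≤ (1 - (∑ i, (√(p i) - √(q i)) ^ 2) / 2) ^ n := by linarith
  nlinarith

/-! ### The Bradley-Terry model -/

/-- The square root is Lipschitz with respect to the logarithm. -/
theorem sq_sqrt_sub_sqrt_le {p q u : ℝ} (hp : 0 ≤ p) (hq : 0 ≤ q)
    (hpq : p ≤ Real.exp u * q) (hqp : q ≤ Real.exp u * p) :
    (√p - √q) ^ 2 ≤ (p + q) * u ^ 2 / 4 := by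
  wlog h : q ≤ p generalizing p q
  · have := this hq hp hqp hpq (le_of_not_ge h)
    calc (√p - √q) ^ 2 = (√q - √p) ^ 2 := by ring
      _ ≤ _ := this
      _ = _ := by ring
  have h1 : √q ≤ √p := Real.sqrt_le_sqrt h
  have h2 : Real.exp (-(u / 2)) * √p ≤ √q := by
    refine Real.le_sqrt_of_sq_le ?_
    rw [mul_pow, Real.sq_sqrt hp, ← Real.exp_nat_mul,
      show ((2 : ℕ) : ℝ) * (-(u / 2)) = -u by push_cast; ring]
    calc Real.exp (-u) * p ≤ Real.exp (-u) * (Real.exp u * q) := by gcongr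
      _ = q := by rw [← mul_assoc, ← Real.exp_add]; simp
  have h3 := Real.add_one_le_exp (-(u / 2))
  have h4 := Real.sqrt_nonneg p
  have h5 : √p - √q ≤ u / 2 * √p := by nlinarith
  -- The larger value `p` is finally relaxed to `p + q`, a symmetric bound that sums to a constant
  -- over the outcomes.
  calc (√p - √q) ^ 2 ≤ (u / 2 * √p) ^ 2 := pow_le_pow_left₀ (by linarith) h5 2
    _ = p * u ^ 2 / 4 := by rw [mul_pow, Real.sq_sqrt hp]; ring
    _ ≤ _ := by gcongr; linarith

/-- The logistic function has logarithmic derivative in `(0, 1)`. Working on this scale controls the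
Hellinger distance without any lower bound on the label probabilities. -/
theorem sigmoid_le_exp_mul {x y u : ℝ} (h : |x - y| ≤ u) :
    Real.sigmoid x ≤ Real.exp u * Real.sigmoid y := by
  have hu : 0 ≤ u := (abs_nonneg _).trans h
  rw [Real.sigmoid_def, Real.sigmoid_def, ← div_eq_mul_inv, inv_eq_one_div,
    div_le_div_iff₀ (by positivity) (by positivity), one_mul, mul_add, ← Real.exp_add, mul_one]
  exact add_le_add (Real.one_le_exp hu) (Real.exp_le_exp.2 (by linarith [(abs_le.1 h).2]))

/-- The squared Hellinger distance of two Bernoulli distributions with logits `x` and `y`. -/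
theorem hellinger_sigmoid_le {x y u : ℝ} (h : |x - y| ≤ u) :
    (√(Real.sigmoid x) - √(Real.sigmoid y)) ^ 2 +
      (√(1 - Real.sigmoid x) - √(1 - Real.sigmoid y)) ^ 2 ≤ u ^ 2 / 2 := by
  have h' : |y - x| ≤ u := by rwa [abs_sub_comm]
  have hn : |-x - -y| ≤ u := by rwa [neg_sub_neg]
  have hn' : |-y - -x| ≤ u := by rwa [neg_sub_neg]
  rw [← Real.sigmoid_neg, ← Real.sigmoid_neg]
  have h1 := sq_sqrt_sub_sqrt_le (Real.sigmoid_nonneg x) (Real.sigmoid_nonneg y)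
    (sigmoid_le_exp_mul h) (sigmoid_le_exp_mul h')
  have h2 := sq_sqrt_sub_sqrt_le (Real.sigmoid_nonneg (-x)) (Real.sigmoid_nonneg (-y))
    (sigmoid_le_exp_mul hn) (sigmoid_le_exp_mul hn')
  have e1 := Real.sigmoid_neg x
  have e2 := Real.sigmoid_neg y
  rw [e1, e2] at h2
  rw [e1, e2]
  linarith

theorem sampleProb_nonneg {d : ℕ} {π₀ : Fin d → ℝ} (hπ : π₀ ∈ stdSimplex ℝ (Fin d))
    (rew : Fin d → ℝ) (s : Fin d × Fin d × Bool) : 0 ≤ sampleProb π₀ rew s := by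
  unfold sampleProb prefProb
  refine mul_nonneg (mul_nonneg (hπ.1 _) (hπ.1 _)) ?_
  split_ifs
  · exact Real.sigmoid_nonneg _
  · exact sub_nonneg.2 (Real.sigmoid_le_one _)

theorem sum_sampleProb {d : ℕ} {π₀ : Fin d → ℝ} (hπ : π₀ ∈ stdSimplex ℝ (Fin d))
    (rew : Fin d → ℝ) : ∑ s, sampleProb π₀ rew s = 1 := by
  have h : ∀ a b, ∑ y, sampleProb π₀ rew (a, b, y) = π₀ a * π₀ b := fun a b => by
    simp [sampleProb]; ring
  simp_rw [Fintype.sum_prod_type, h, ← Finset.mul_sum, hπ.2, mul_one]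
  exact hπ.2

/-- The squared Hellinger distance between the laws of a labeled pair under two rewards that differ
only at the action `b`. -/
theorem hellinger_sampleProb_le {d : ℕ} {π₀ : Fin d → ℝ} (hπ : π₀ ∈ stdSimplex ℝ (Fin d))
    {rew rew' : Fin d → ℝ} {b : Fin d} {u : ℝ} (hne : ∀ a, a ≠ b → rew a = rew' a)
    (hb : |rew b - rew' b| ≤ u) :
    ∑ s, (√(sampleProb π₀ rew s) - √(sampleProb π₀ rew' s)) ^ 2 ≤ 4 * u ^ 2 * π₀ b := by
  have hu : 0 ≤ u := (abs_nonneg _).trans hb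
  have hall : ∀ a, |rew a - rew' a| ≤ u := fun a => by
    by_cases h : a = b
    · rwa [h]
    · simpa [hne a h] using hu
  -- Only pairs containing `b` contribute. Their logits move by at most `2 * u`, and their total
  -- mass is at most `2 * π₀ b`.
  have key : ∀ a₁ a₂, ∑ y, (√(sampleProb π₀ rew (a₁, a₂, y)) -
      √(sampleProb π₀ rew' (a₁, a₂, y))) ^ 2 ≤
      2 * u ^ 2 * (π₀ a₁ * (if a₂ = b then π₀ a₂ else 0) +
        (if a₁ = b then π₀ a₁ else 0) * π₀ a₂) := fun a₁ a₂ => by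
    have hw : 0 ≤ π₀ a₁ * π₀ a₂ := mul_nonneg (hπ.1 _) (hπ.1 _)
    by_cases h : a₁ = b ∨ a₂ = b
    · have h1 : |(rew a₁ - rew a₂) - (rew' a₁ - rew' a₂)| ≤ 2 * u := by
        have e1 := abs_le.1 (hall a₁)
        have e2 := abs_le.1 (hall a₂)
        exact abs_le.2 ⟨by linarith, by linarith⟩
      have h2 := hellinger_sigmoid_le h1
      have h3 : π₀ a₁ * π₀ a₂ ≤ π₀ a₁ * (if a₂ = b then π₀ a₂ else 0) +
          (if a₁ = b then π₀ a₁ else 0) * π₀ a₂ := by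
        rcases h with h | h <;> split_ifs <;> simp_all
      calc _ = π₀ a₁ * π₀ a₂ * ((√(Real.sigmoid (rew a₁ - rew a₂)) -
              √(Real.sigmoid (rew' a₁ - rew' a₂))) ^ 2 + (√(1 - Real.sigmoid (rew a₁ - rew a₂)) -
              √(1 - Real.sigmoid (rew' a₁ - rew' a₂))) ^ 2) := by
            simp only [Fintype.univ_bool, sampleProb, prefProb, Finset.mem_singleton,
              Bool.true_eq_false, not_false_eq_true, Finset.sum_insert, if_true,
              Finset.sum_singleton, Bool.false_eq_true, if_false, Real.sqrt_mul hw]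
            rw [← mul_sub, ← mul_sub, mul_pow, mul_pow, Real.sq_sqrt hw, mul_add]
        _ ≤ π₀ a₁ * π₀ a₂ * ((2 * u) ^ 2 / 2) := by gcongr
        _ = 2 * u ^ 2 * (π₀ a₁ * π₀ a₂) := by ring
        _ ≤ _ := by gcongr
    · rw [not_or] at h
      simp [sampleProb, prefProb, hne _ h.1, hne _ h.2, h.1, h.2]
  calc ∑ s, (√(sampleProb π₀ rew s) - √(sampleProb π₀ rew' s)) ^ 2
      ≤ ∑ a₁, ∑ a₂, 2 * u ^ 2 * (π₀ a₁ * (if a₂ = b then π₀ a₂ else 0) +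
        (if a₁ = b then π₀ a₁ else 0) * π₀ a₂) := by
        simp_rw [Fintype.sum_prod_type]
        exact Finset.sum_le_sum fun a₁ _ => Finset.sum_le_sum fun a₂ _ => key a₁ a₂
    _ = 4 * u ^ 2 * π₀ b := by
        simp only [← Finset.mul_sum, Finset.sum_add_distrib, ← Finset.sum_mul, hπ.2,
          Finset.sum_ite_eq' Finset.univ b, Finset.mem_univ, if_true]
        ring

/-! ### Assouad's lemma -/

/-- A vertex of the cube of half-width `δ` about `φ` in the coordinates of `S`. -/
noncomputable def cubeVertex {d : ℕ} (φ : Fin d → ℝ) (S : Finset (Fin d)) (δ : ℝ)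
    (v : Fin d → Bool) (b : Fin d) : ℝ :=
  φ b + if b ∈ S then (if v b then δ else -δ) else 0

/-- Flip one bit. -/
def flip {d : ℕ} (b : Fin d) (v : Fin d → Bool) : Fin d → Bool := Function.update v b (!v b)

theorem flip_involutive {d : ℕ} (b : Fin d) : Function.Involutive (flip b) := fun v => by
  simp [flip]

theorem cubeVertex_flip_of_ne {d : ℕ} (φ : Fin d → ℝ) (S : Finset (Fin d)) (δ : ℝ)
    (v : Fin d → Bool) {a b : Fin d} (h : a ≠ b) :
    cubeVertex φ S δ (flip b v) a = cubeVertex φ S δ v a := by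
  simp [cubeVertex, flip, h]

theorem abs_cubeVertex_sub_flip {d : ℕ} (φ : Fin d → ℝ) {S : Finset (Fin d)} {δ : ℝ} (hδ : 0 ≤ δ)
    (v : Fin d → Bool) {b : Fin d} (hb : b ∈ S) :
    |cubeVertex φ S δ v b - cubeVertex φ S δ (flip b v) b| = 2 * δ := by
  have : |δ + δ| = 2 * δ := by rw [abs_of_nonneg (by linarith)]; ring
  have : |-δ - δ| = 2 * δ := by rw [abs_of_nonpos (by linarith)]; ring
  cases h : v b <;> simp_all [cubeVertex, flip]

theorem expect_mono {d n : ℕ} {π₀ : Fin d → ℝ} (hπ : π₀ ∈ stdSimplex ℝ (Fin d))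
    (rew : Fin d → ℝ) {f g : Dataset d n → ℝ} (hf : ∀ D, f D ≤ g D) :
    expect π₀ rew f ≤ expect π₀ rew g :=
  Finset.sum_le_sum fun D _ => mul_le_mul_of_nonneg_left (hf D)
    (Finset.prod_nonneg fun _ _ => sampleProb_nonneg hπ _ _)

theorem expect_sum {ι : Type*} {d n : ℕ} (π₀ rew : Fin d → ℝ) (S : Finset ι)
    (f : ι → Dataset d n → ℝ) :
    expect π₀ rew (fun D => ∑ b ∈ S, f b D) = ∑ b ∈ S, expect π₀ rew (f b) := by
  simp only [expect, Finset.mul_sum]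
  exact Finset.sum_comm

/-- Le Cam's two-point bound for rewards that differ at one action. -/
theorem twoPoint_le_expect_add {d n : ℕ} {π₀ : Fin d → ℝ} (hπ : π₀ ∈ stdSimplex ℝ (Fin d))
    {rew rew' : Fin d → ℝ} {b : Fin d} {u Δ : ℝ} (hne : ∀ a, a ≠ b → rew a = rew' a)
    (hb : |rew b - rew' b| ≤ u) (hn : n * (4 * u ^ 2 * π₀ b) ≤ 1) (hΔ : 0 ≤ Δ)
    {f g : Dataset d n → ℝ} (hf : ∀ D, 0 ≤ f D) (hg : ∀ D, 0 ≤ g D) (hfg : ∀ D, Δ ≤ f D + g D) :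
    Δ / 8 ≤ expect π₀ rew f + expect π₀ rew' g := by
  have h := eighth_le_sum_min_prod (sampleProb_nonneg hπ rew) (sampleProb_nonneg hπ rew')
    (sum_sampleProb hπ rew) (sum_sampleProb hπ rew') n
    ((mul_le_mul_of_nonneg_left (hellinger_sampleProb_le hπ hne hb) n.cast_nonneg).trans hn)
  calc Δ / 8 = 1 / 8 * Δ := by ring
    _ ≤ (∑ D : Dataset d n, min (∏ i, sampleProb π₀ rew (D i))
          (∏ i, sampleProb π₀ rew' (D i))) * Δ := by gcongr
    _ = ∑ D : Dataset d n, min (∏ i, sampleProb π₀ rew (D i))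
          (∏ i, sampleProb π₀ rew' (D i)) * Δ := Finset.sum_mul _ _ _
    _ ≤ ∑ D : Dataset d n, ((∏ i, sampleProb π₀ rew (D i)) * f D +
          (∏ i, sampleProb π₀ rew' (D i)) * g D) := by
        refine Finset.sum_le_sum fun D _ => ?_
        have h0 : 0 ≤ min (∏ i, sampleProb π₀ rew (D i)) (∏ i, sampleProb π₀ rew' (D i)) :=
          le_min (Finset.prod_nonneg fun _ _ => sampleProb_nonneg hπ _ _)
            (Finset.prod_nonneg fun _ _ => sampleProb_nonneg hπ _ _)
        calc _ ≤ min (∏ i, sampleProb π₀ rew (D i)) (∏ i, sampleProb π₀ rew' (D i)) *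
              (f D + g D) := mul_le_mul_of_nonneg_left (hfg D) h0
          _ = _ := mul_add _ _ _
          _ ≤ _ := add_le_add (mul_le_mul_of_nonneg_right (min_le_left _ _) (hf D))
              (mul_le_mul_of_nonneg_right (min_le_right _ _) (hg D))
    _ = _ := Finset.sum_add_distrib

/-- Assouad's lemma for the preference model: the minimax risk over a class that contains a cube,
for a loss that separates over the coordinates of the cube. -/
theorem assouad_le_minimaxRisk {d n : ℕ} {π₀ φ : Fin d → ℝ} (hπ : π₀ ∈ stdSimplex ℝ (Fin d))
    {S : Finset (Fin d)} {δ γ Δ : ℝ} (hδ : 0 ≤ δ) (hγ : 0 ≤ γ) (hΔ : 0 ≤ Δ)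
    (hn : ∀ b ∈ S, n * (16 * γ ^ 2 * δ ^ 2 * π₀ b) ≤ 1)
    {loss : (Fin d → ℝ) → (Fin d → ℝ) → ℝ}
    (ℓ : Fin d → (Fin d → ℝ) → (Fin d → Bool) → ℝ) (hℓ : ∀ b t v, 0 ≤ ℓ b t v)
    (hflip : ∀ b ∈ S, ∀ t v, Δ ≤ ℓ b t v + ℓ b t (flip b v))
    (hloss : ∀ t v, ∑ b ∈ S, ℓ b t v ≤ loss t (cubeVertex φ S δ v))
    {Θ : Set (Fin d → ℝ)} (hΘ : ∀ v, cubeVertex φ S δ v ∈ Θ) :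
    ENNReal.ofReal (S.card * Δ / 16) ≤ minimaxRisk n γ π₀ Θ loss := by
  refine le_iInf fun est => ?_
  set rew : (Fin d → Bool) → Fin d → ℝ :=
    fun v a => γ * (cubeVertex φ S δ v ⬝ᵥ feature a) with hrew
  have hrew' : ∀ v a, rew v a = γ * cubeVertex φ S δ v a := fun v a => by simp [hrew, feature]
  have hpair : ∀ b ∈ S, ∀ v, Δ / 8 ≤ expect π₀ (rew v) (fun D => ℓ b (est D) v) +
      expect π₀ (rew (flip b v)) (fun D => ℓ b (est D) (flip b v)) := fun b hb v => by
    refine twoPoint_le_expect_add hπ (b := b) (u := 2 * γ * δ) (fun a ha => ?_) ?_ ?_ hΔ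
      (fun D => hℓ _ _ _) (fun D => hℓ _ _ _) fun D => hflip b hb _ _
    · rw [hrew', hrew', cubeVertex_flip_of_ne _ _ _ _ ha]
    · rw [hrew', hrew', ← mul_sub, abs_mul, abs_cubeVertex_sub_flip φ hδ v hb, abs_of_nonneg hγ]
      exact le_of_eq (by ring)
    · refine le_trans (le_of_eq ?_) (hn b hb)
      ring
  -- Flipping a bit permutes the cube, so summing the two-point bound over all vertices counts each
  -- risk twice; hence 16 in place of 8.
  have hsum : ∀ b ∈ S, ∑ _v : Fin d → Bool, Δ / 16 ≤
      ∑ v, expect π₀ (rew v) (fun D => ℓ b (est D) v) := fun b hb => by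
    have h1 := Finset.sum_le_sum fun v (_ : v ∈ Finset.univ) => hpair b hb v
    rw [Finset.sum_add_distrib, (flip_involutive b).bijective.sum_comp
      fun v => expect π₀ (rew v) (fun D => ℓ b (est D) v)] at h1
    have h2 : ∑ _v : Fin d → Bool, Δ / 8 = 2 * ∑ _v : Fin d → Bool, Δ / 16 := by
      rw [Finset.mul_sum]; exact Finset.sum_congr rfl fun _ _ => by ring
    linarith
  -- Some vertex has at least the average risk.
  obtain ⟨v, -, hv⟩ : ∃ v ∈ (Finset.univ : Finset (Fin d → Bool)), S.card * Δ / 16 ≤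
      expect π₀ (rew v) (fun D => loss (est D) (cubeVertex φ S δ v)) := by
    refine Finset.exists_le_of_sum_le Finset.univ_nonempty ?_
    calc ∑ _v : Fin d → Bool, S.card * Δ / 16 = ∑ _b ∈ S, ∑ _v : Fin d → Bool, Δ / 16 := by
          simp only [Finset.sum_const, nsmul_eq_mul]; ring
      _ ≤ ∑ b ∈ S, ∑ v, expect π₀ (rew v) (fun D => ℓ b (est D) v) := Finset.sum_le_sum hsum
      _ = ∑ v, expect π₀ (rew v) (fun D => ∑ b ∈ S, ℓ b (est D) v) := by
          rw [Finset.sum_comm]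
          exact Finset.sum_congr rfl fun v _ => (expect_sum _ _ _ _).symm
      _ ≤ _ := Finset.sum_le_sum fun v _ => expect_mono hπ _ fun D => hloss _ _
  exact (ENNReal.ofReal_le_ofReal hv).trans
    (le_iSup₂ (f := fun θs (_ : θs ∈ Θ) => ENNReal.ofReal (expect π₀
      (fun a => γ * (θs ⬝ᵥ feature a)) fun D => loss (est D) θs)) _ (hΘ v))

/-! ### The norms -/

theorem abs_le_vecNorm {d : ℕ} {p : ℝ≥0∞} (hp : 1 ≤ p) (x : Fin d → ℝ) (a : Fin d) :
    |x a| ≤ vecNorm p x := by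
  have : Fact (1 ≤ p) := ⟨hp⟩
  exact PiLp.norm_apply_le (WithLp.toLp p x : PiLp p (fun _ : Fin d => ℝ)) a

theorem vecNorm_smul {d : ℕ} {p : ℝ≥0∞} (hp : 1 ≤ p) (c : ℝ) (x : Fin d → ℝ) :
    vecNorm p (c • x) = |c| * vecNorm p x := by
  have : Fact (1 ≤ p) := ⟨hp⟩
  exact norm_smul c (WithLp.toLp p x : PiLp p (fun _ : Fin d => ℝ))

theorem vecNorm_add_le {d : ℕ} {p : ℝ≥0∞} (hp : 1 ≤ p) (x y : Fin d → ℝ) :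
    vecNorm p (x + y) ≤ vecNorm p x + vecNorm p y := by
  have : Fact (1 ≤ p) := ⟨hp⟩
  exact norm_add_le (WithLp.toLp p x : PiLp p (fun _ : Fin d => ℝ)) (WithLp.toLp p y)

theorem vecNorm_zero {d : ℕ} {p : ℝ≥0∞} (hp : 1 ≤ p) : vecNorm p (0 : Fin d → ℝ) = 0 := by
  have : Fact (1 ≤ p) := ⟨hp⟩
  exact norm_zero (E := PiLp p (fun _ : Fin d => ℝ))

theorem vecNorm_sum_le {ι : Type*} {d : ℕ} {p : ℝ≥0∞} (hp : 1 ≤ p) (S : Finset ι)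
    (f : ι → Fin d → ℝ) : vecNorm p (∑ i ∈ S, f i) ≤ ∑ i ∈ S, vecNorm p (f i) :=
  Finset.le_sum_of_subadditive _ (vecNorm_zero hp).le (vecNorm_add_le hp) S f

theorem vecNorm_single {d : ℕ} {p : ℝ≥0∞} (hp : 1 ≤ p) (a : Fin d) (c : ℝ) :
    vecNorm p (Pi.single a c) = |c| := by
  have : Fact (1 ≤ p) := ⟨hp⟩
  exact PiLp.norm_single p (fun _ : Fin d => ℝ) a c

theorem vecNorm_one {d : ℕ} (x : Fin d → ℝ) : vecNorm 1 x = ∑ a, |x a| :=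
  PiLp.norm_eq_of_L1 (WithLp.toLp 1 x : PiLp 1 (fun _ : Fin d => ℝ))

/-- The triangle inequality over coordinates bounds every `L^p` norm by the `L¹` norm. This is crude
for `p > 1`, but there the cube has a single coordinate. -/
theorem cubeVertex_mem_lpBall {d : ℕ} {p : ℝ≥0∞} (hp : 1 ≤ p) (φ : Fin d → ℝ)
    {S : Finset (Fin d)} {δ : ℝ} (hδ : 0 ≤ δ) (hS : S.card * δ ≤ 1) (v : Fin d → Bool) :
    cubeVertex φ S δ v ∈ lpBall p φ 1 := by
  have h : cubeVertex φ S δ v - φ = ∑ b ∈ S, Pi.single b (if v b then δ else -δ) := by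
    ext a
    simp [cubeVertex, Finset.sum_apply, Pi.single_apply]
  have h2 : ∀ b ∈ S, vecNorm p (Pi.single b (if v b then δ else -δ) : Fin d → ℝ) ≤ δ :=
    fun b _ => by
      rw [vecNorm_single hp]
      split_ifs <;> simp [abs_of_nonneg hδ]
  show vecNorm p _ ≤ 1
  rw [h]
  refine (vecNorm_sum_le hp _ _).trans ((Finset.sum_le_sum h2).trans ?_)
  simpa using hS

/-! ### Softmax policies -/

/-- The uniform base policy tilted by `w`. -/
noncomputable def softmax {d : ℕ} (w : Fin d → ℝ) (a : Fin d) : ℝ :=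
  Real.exp (w a) / ∑ b, Real.exp (w b)

theorem sum_exp_pos {d : ℕ} [NeZero d] (w : Fin d → ℝ) : 0 < ∑ b, Real.exp (w b) :=
  Finset.sum_pos (fun _ _ => Real.exp_pos _) Finset.univ_nonempty

theorem softmax_pos {d : ℕ} [NeZero d] (w : Fin d → ℝ) (a : Fin d) : 0 < softmax w a :=
  div_pos (Real.exp_pos _) (sum_exp_pos w)

theorem sum_softmax {d : ℕ} [NeZero d] (w : Fin d → ℝ) : ∑ a, softmax w a = 1 := by
  simp_rw [softmax, ← Finset.sum_div]
  exact div_self (sum_exp_pos w).ne'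

theorem softmax_mem_stdSimplex {d : ℕ} [NeZero d] (w : Fin d → ℝ) :
    softmax w ∈ stdSimplex ℝ (Fin d) :=
  ⟨fun a => (softmax_pos w a).le, sum_softmax w⟩

/-- The base weights `exp (-φ)` merely translate the parameter, so the construction reduces to
choosing `φ`. -/
theorem policy_softmax {d : ℕ} [NeZero d] (φ θ : Fin d → ℝ) :
    policy (softmax (-φ)) θ = softmax (θ - φ) := by
  ext a
  have h := (sum_exp_pos (-φ)).ne'
  have e : ∀ b, softmax (-φ) b * Real.exp (θ ⬝ᵥ feature b) =
      Real.exp ((θ - φ) b) / ∑ b, Real.exp ((-φ) b) := fun b => by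
    rw [softmax, div_mul_eq_mul_div, ← Real.exp_add]
    simp [feature, sub_eq_neg_add]
  simp_rw [policy, e, ← Finset.sum_div, softmax]
  rw [div_div_div_cancel_right₀ h]

theorem policy_softmax_self {d : ℕ} [NeZero d] (φ : Fin d → ℝ) (a : Fin d) :
    policy (softmax (-φ)) φ a = 1 / (d : ℝ) := by
  simp [policy_softmax, softmax]

theorem isNearUniformClass_lpBall {d : ℕ} [NeZero d] {p : ℝ≥0∞} (hp : 1 ≤ p) {R : ℝ}
    {φ : Fin d → ℝ} (hφ : vecNorm p φ ≤ R - 1) :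
    IsNearUniformClass p R (softmax (-φ)) (lpBall p φ 1) := by
  refine ⟨fun θ hθ => ?_, φ, policy_softmax_self φ, rfl⟩
  have h := vecNorm_add_le hp (θ - φ) φ
  have h1 : vecNorm p (θ - φ) ≤ 1 := hθ
  show vecNorm p (θ - 0) ≤ R
  rw [sub_add_cancel] at h
  rw [sub_zero]
  linarith

/-! ### Coverage -/

theorem dotProduct_featureCov_mulVec {d : ℕ} (π x : Fin d → ℝ) :
    x ⬝ᵥ (featureCov π).mulVec x = ∑ a, π a * (x a - ∑ b, π b * x b) ^ 2 := by
  have h : ∀ a, x ⬝ᵥ (feature a - meanFeature π) = x a - ∑ b, π b * x b := fun a => by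
    simp [dotProduct_sub, meanFeature, dotProduct_sum, feature, dotProduct_smul]
  rw [featureCov, Matrix.sum_mulVec, dotProduct_sum]
  refine Finset.sum_congr rfl fun a _ => ?_
  rw [Matrix.smul_mulVec, dotProduct_smul, Matrix.vecMulVec_mulVec, smul_eq_mul, ← h, sq,
    dotProduct_comm _ x]
  congr 1
  simp [dotProduct_smul]

theorem isHermitian_featureCov {d : ℕ} (π : Fin d → ℝ) : (featureCov π).IsHermitian := by
  rw [Matrix.IsHermitian, Matrix.conjTranspose_eq_transpose_of_trivial, featureCov,
    Matrix.transpose_sum]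
  exact Finset.sum_congr rfl fun a _ => by rw [Matrix.transpose_smul, Matrix.transpose_vecMulVec]

/-- The mean minimises the mean squared deviation. -/
theorem variance_le {d : ℕ} {π : Fin d → ℝ} (hπ : ∑ a, π a = 1) (x : Fin d → ℝ) (m : ℝ) :
    ∑ a, π a * (x a - ∑ b, π b * x b) ^ 2 ≤ ∑ a, π a * (x a - m) ^ 2 := by
  set μ := ∑ b, π b * x b with hμ
  have h : ∑ a, π a * (x a - m) ^ 2 = ∑ a, π a * (x a - μ) ^ 2 + (μ - m) ^ 2 := by
    have e : ∀ a, π a * (x a - m) ^ 2 =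
        π a * (x a - μ) ^ 2 + ((μ - m) ^ 2 - 2 * μ * (μ - m)) * π a + 2 * (μ - m) * (π a * x a) :=
      fun a => by ring
    simp_rw [e, Finset.sum_add_distrib, ← Finset.mul_sum, ← hμ, hπ]
    ring
  rw [h]
  linarith [sq_nonneg (μ - m)]

/-- A bound on the likelihood ratio bounds the coverage. -/
theorem coverage_le {d : ℕ} {π π' : Fin d → ℝ} (hπ' : ∑ a, π' a = 1) {C : ℝ} (hC : 0 < C)
    (h : ∀ a, π' a ≤ C * π a) : coverage π π' ≤ ENNReal.ofReal C := by
  refine iInf_le_of_le C (iInf_le_of_le hC (iInf_le_of_le ?_ le_rfl))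
  refine .of_dotProduct_mulVec_nonneg
    (((isHermitian_featureCov π).smul (IsSelfAdjoint.all C)).sub (isHermitian_featureCov π'))
    fun x => ?_
  rw [star_trivial, Matrix.sub_mulVec, Matrix.smul_mulVec, dotProduct_sub, dotProduct_smul,
    dotProduct_featureCov_mulVec, dotProduct_featureCov_mulVec, smul_eq_mul, sub_nonneg]
  -- Recentring the `π'` variance at the `π` mean lets the two sums be compared term by term.
  refine (variance_le hπ' x (∑ b, π b * x b)).trans ?_
  rw [Finset.mul_sum]
  refine Finset.sum_le_sum fun a _ => ?_
  rw [← mul_assoc]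
  exact mul_le_mul_of_nonneg_right (h a) (sq_nonneg _)

/-- With one action every covariance vanishes, so every `C > 0` is admissible and the infimum is 0.
-/
theorem localCoverage_eq_zero (p : ℝ≥0∞) (φ θ₁ : Fin 1 → ℝ) (R : ℝ) :
    localCoverage p (softmax (-φ)) θ₁ R = 0 := by
  have h : ∀ π : Fin 1 → ℝ, π 0 = 1 → featureCov π = 0 := fun π hπ => by
    simp [featureCov, meanFeature, hπ]
  refine le_antisymm (iSup₂_le fun θ _ => ?_) zero_le
  have h1 : ∀ θ : Fin 1 → ℝ, featureCov (policy (softmax (-φ)) θ) = 0 := fun θ => by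
    refine h _ ?_
    have := sum_softmax (θ - φ)
    rwa [← policy_softmax, Fin.sum_univ_one] at this
  refine le_of_forall_pos_le_add fun ε hε => ?_
  rw [zero_add]
  obtain ⟨C, hC, hCε⟩ : ∃ C : ℝ, 0 < C ∧ ENNReal.ofReal C ≤ ε := by
    by_cases hε' : ε = ⊤
    · exact ⟨1, one_pos, hε' ▸ le_top⟩
    · exact ⟨ε.toReal, ENNReal.toReal_pos hε.ne' hε', (ENNReal.ofReal_toReal hε').le⟩
  refine (iInf_le_of_le C (iInf_le_of_le hC (iInf_le_of_le ?_ le_rfl))).trans hCε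
  rw [h1, h1, smul_zero, sub_zero]
  exact Matrix.PosSemidef.zero

/-- The largest likelihood ratio between near-uniform policies and their tilts by vectors of norm
at most `R` bounds the local coverage. -/
theorem localCoverage_le {d : ℕ} [NeZero d] {p : ℝ≥0∞} (hp : 1 ≤ p) {φ θ₁ : Fin d → ℝ}
    (hθ₁ : θ₁ ∈ lpBall p φ 1) {R K : ℝ} (hK0 : 0 < K)
    (hK : ∀ x : Fin d → ℝ, vecNorm p x ≤ R → ∀ a, ∑ b, Real.exp (x b) ≤ K * d * Real.exp (x a)) :
    localCoverage p (softmax (-φ)) θ₁ R ≤ ENNReal.ofReal (Real.exp 2 * K) := by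
  refine iSup₂_le fun θ hθ => ?_
  have hw : ∀ a, |(θ₁ - φ) a| ≤ 1 := fun a => (abs_le_vecNorm hp _ a).trans hθ₁
  have hx := hK (θ - θ₁) hθ
  rw [policy_softmax, policy_softmax]
  refine coverage_le (sum_softmax _) (by positivity) fun a => ?_
  rw [softmax, softmax, ← mul_div_assoc, div_le_div_iff₀ (sum_exp_pos _) (sum_exp_pos _)]
  have e1 : ∀ b, (θ - φ) b = (θ₁ - φ) b + (θ - θ₁) b := fun b => by simp
  -- The factor `exp 2` has two sources: one `exp 1` here, and one from the normaliser of the target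
  -- policy in `h2`.
  have h1 : ∑ b, Real.exp ((θ - φ) b) ≤ Real.exp 1 * ∑ b, Real.exp ((θ - θ₁) b) := by
    rw [Finset.mul_sum]
    refine Finset.sum_le_sum fun b _ => ?_
    rw [← Real.exp_add, e1]
    exact Real.exp_le_exp.2 (by linarith [(abs_le.1 (hw b)).2])
  have h2 : d * Real.exp (-1) ≤ ∑ b, Real.exp ((θ₁ - φ) b) := by
    calc d * Real.exp (-1) = ∑ _b : Fin d, Real.exp (-1) := by simp
      _ ≤ _ := Finset.sum_le_sum fun b _ => Real.exp_le_exp.2 (abs_le.1 (hw b)).1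
  calc Real.exp ((θ₁ - φ) a) * ∑ b, Real.exp ((θ - φ) b)
      ≤ Real.exp ((θ₁ - φ) a) * (Real.exp 1 * (K * d * Real.exp ((θ - θ₁) a))) := by
        gcongr
        exact h1.trans (by gcongr; exact hx a)
    _ = Real.exp 2 * K * (Real.exp ((θ₁ - φ) a) * Real.exp ((θ - θ₁) a)) *
          (d * Real.exp (-1)) := by
        rw [show (2 : ℝ) = 1 + 1 by norm_num, Real.exp_add, Real.exp_neg]
        field_simp
    _ = Real.exp 2 * K * Real.exp ((θ - φ) a) * (d * Real.exp (-1)) := by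
        rw [← Real.exp_add, ← e1]
    _ ≤ _ := by gcongr

/-! ### Divergence -/

/-- The divergence dominates the squared Hellinger distance. -/
theorem hellinger_le_klDivergence {d : ℕ} {π π' : Fin d → ℝ} (hπ : ∀ a, 0 < π a)
    (hπ' : ∀ a, 0 < π' a) (h1 : ∑ a, π a = 1) (h1' : ∑ a, π' a = 1) :
    ∑ a, (√(π a) - √(π' a)) ^ 2 ≤ klDivergence π π' := by
  -- This is `log t ≤ t - 1` at `t = √(π' a / π a)`. The extra terms `π a - π' a` cancel on
  -- summation.
  have h : ∀ a, (√(π a) - √(π' a)) ^ 2 + π a - π' a ≤ π a * Real.log (π a / π' a) := fun a => by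
    have ha := Real.sqrt_pos.2 (hπ a)
    have ha' := Real.sqrt_pos.2 (hπ' a)
    have e := Real.sq_sqrt (hπ a).le
    have e' := Real.sq_sqrt (hπ' a).le
    have hl := Real.log_le_sub_one_of_pos (div_pos ha' ha)
    have hlog : Real.log (π a / π' a) = -2 * Real.log (√(π' a) / √(π a)) := by
      rw [Real.log_div ha'.ne' ha.ne', Real.log_sqrt (hπ a).le, Real.log_sqrt (hπ' a).le,
        Real.log_div (hπ a).ne' (hπ' a).ne']
      ring
    rw [hlog]
    calc (√(π a) - √(π' a)) ^ 2 + π a - π' a = √(π a) ^ 2 * (-2 * (√(π' a) / √(π a) - 1)) := by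
          field_simp
          nlinarith
      _ ≤ π a * (-2 * Real.log (√(π' a) / √(π a))) := by
          rw [e]
          exact mul_le_mul_of_nonneg_left (by linarith) (hπ a).le
  have hs := Finset.sum_le_sum fun a (_ : a ∈ Finset.univ) => h a
  rw [Finset.sum_sub_distrib, Finset.sum_add_distrib, h1, h1'] at hs
  simpa [klDivergence] using hs

/-- How far the probability of an action moves when its weight is changed by a factor
`exp (2 * δ)`. -/
theorem sq_sqrt_sub_sqrt_odds_ge {d s δ : ℝ} (hδ : 0 ≤ δ) (hδ1 : δ ≤ 1) (hs : Real.exp (-1) ≤ s)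
    (hsd : s + 1 ≤ Real.exp 1 * d) :
    δ ^ 2 / (4 * Real.exp 3 * d) ≤
      (√(Real.exp δ / (s + Real.exp δ)) - √(Real.exp (-δ) / (s + Real.exp (-δ)))) ^ 2 := by
  have hs0 : 0 < s := (Real.exp_pos _).trans_le hs
  have hd : 0 < d := by
    by_contra h
    nlinarith [Real.exp_pos 1]
  set x := Real.exp δ / (s + Real.exp δ) with hx
  set y := Real.exp (-δ) / (s + Real.exp (-δ)) with hy
  have hx0 : 0 < x := by positivity
  have hy0 : 0 < y := by positivity
  have hxy : x - y = s * x * y * (Real.exp δ - Real.exp (-δ)) := by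
    rw [hx, hy, Real.exp_neg]
    field_simp
    ring
  have hsinh : 2 * δ ≤ Real.exp δ - Real.exp (-δ) := by
    have := Real.self_le_sinh_iff.2 hδ
    rw [Real.sinh_eq] at this
    linarith
  have hdiff : 2 * δ * (s * x * y) ≤ x - y := by
    rw [hxy, mul_comm]
    exact mul_le_mul_of_nonneg_left hsinh (by positivity)
  have hyx : y ≤ x := by linarith [show 0 ≤ 2 * δ * (s * x * y) by positivity]
  -- Indeed `s * y = 1 / (exp δ + 1 / s)`, and both terms of the denominator are at most `exp 1`.
  have hsy : 1 / (2 * Real.exp 1) ≤ s * y := by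
    rw [hy, ← mul_div_assoc, div_le_div_iff₀ (by positivity) (by positivity)]
    have h1 : Real.exp (-1) ≤ Real.exp (-δ) := Real.exp_le_exp.2 (by linarith)
    have h2 : Real.exp (-δ) ≤ 1 := Real.exp_le_one_iff.2 (by linarith)
    have h3 : Real.exp (-1) * Real.exp 1 = 1 := by rw [← Real.exp_add]; simp
    have h4 := mul_le_mul_of_nonneg_right h1 (Real.exp_pos 1).le
    have h5 := mul_le_mul_of_nonneg_right hs (Real.exp_pos 1).le
    have h6 := mul_le_mul_of_nonneg_left h4 hs0.le
    have h7 := mul_le_mul_of_nonneg_right h5 (Real.exp_pos (-δ)).le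
    nlinarith
  have hxd : 1 / (Real.exp 1 * d) ≤ x := by
    have h1 : 1 ≤ Real.exp δ := Real.one_le_exp hδ
    calc 1 / (Real.exp 1 * d) ≤ 1 / (s + 1) := one_div_le_one_div_of_le (by positivity) hsd
      _ ≤ x := by
        rw [hx, div_le_div_iff₀ (by positivity) (by positivity)]
        nlinarith
  have hX := Real.sqrt_pos.2 hx0
  have eX := Real.sq_sqrt hx0.le
  have eY := Real.sq_sqrt hy0.le
  have hYX : √y ≤ √x := Real.sqrt_le_sqrt hyx
  have hroot : δ * (s * y) * √x ≤ √x - √y := by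
    have h1 : x - y = (√x - √y) * (√x + √y) := by nlinarith
    have h2 : (√x - √y) * (√x + √y) ≤ (√x - √y) * (2 * √x) :=
      mul_le_mul_of_nonneg_left (by linarith) (by linarith)
    have h3 : 2 * √x * (δ * (s * y) * √x) ≤ 2 * √x * (√x - √y) := by
      calc 2 * √x * (δ * (s * y) * √x) = 2 * δ * (s * √x ^ 2 * y) := by ring
        _ = 2 * δ * (s * x * y) := by rw [eX]
        _ ≤ _ := by linarith
    exact le_of_mul_le_mul_left h3 (by positivity)
  calc δ ^ 2 / (4 * Real.exp 3 * d)
      = δ ^ 2 * (1 / (2 * Real.exp 1)) ^ 2 * (1 / (Real.exp 1 * d)) := by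
        rw [show Real.exp 3 = Real.exp 1 ^ 3 by rw [← Real.exp_nat_mul]; norm_num]
        field_simp
        norm_num
    _ ≤ δ ^ 2 * (s * y) ^ 2 * x := by gcongr
    _ = (δ * (s * y) * √x) ^ 2 := by rw [mul_pow _ √x, eX]; ring
    _ ≤ _ := pow_le_pow_left₀ (by positivity) hroot 2

/-! ### Calibration of the cube -/

/-- The left side is monotone in the coverage, so only an upper bound `K` on it is needed and the
calibration takes place in the reals. -/
theorem ofReal_mul_min_sqrt_le {C : ℝ≥0∞} {K c r a : ℝ} {n : ℕ} (hn : 1 ≤ n) (ha : 0 ≤ a)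
    (hc : 0 ≤ c) (hK : 0 ≤ K) (hC : C ≤ ENNReal.ofReal K) (hr : c * min (a * √(K / n)) 1 ≤ r) :
    ENNReal.ofReal c * min (ENNReal.ofReal a * (C / n) ^ (1 / 2 : ℝ)) 1 ≤ ENNReal.ofReal r := by
  have hn0 : (0 : ℝ) < n := by exact_mod_cast hn
  refine le_trans ?_ (ENNReal.ofReal_le_ofReal hr)
  rw [ENNReal.ofReal_mul hc, ENNReal.ofReal_min, ENNReal.ofReal_mul ha, ENNReal.ofReal_one,
    Real.sqrt_eq_rpow, ← ENNReal.ofReal_rpow_of_nonneg (by positivity) (by norm_num),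
    ENNReal.ofReal_div_of_pos hn0, ENNReal.ofReal_natCast]
  gcongr

theorem ofReal_mul_min_le {C : ℝ≥0∞} {K c r : ℝ} {n d : ℕ} (hn : 1 ≤ n) (hd : 1 ≤ d)
    (hc : 0 ≤ c) (hC : C ≤ ENNReal.ofReal K) (hr : c * min (K / n) (1 / (d : ℝ) ^ 2) ≤ r) :
    ENNReal.ofReal c * min (C / n) (1 / (d : ℝ≥0∞) ^ 2) ≤ ENNReal.ofReal r := by
  have hn0 : (0 : ℝ) < n := by exact_mod_cast hn
  have hd0 : (0 : ℝ) < d := by exact_mod_cast hd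
  refine le_trans ?_ (ENNReal.ofReal_le_ofReal hr)
  rw [ENNReal.ofReal_mul hc, ENNReal.ofReal_min, ENNReal.ofReal_div_of_pos hn0,
    ENNReal.ofReal_div_of_pos (by positivity), ENNReal.ofReal_pow hd0.le, ENNReal.ofReal_natCast,
    ENNReal.ofReal_natCast, ENNReal.ofReal_one]
  gcongr

/-- A perturbation of size at most `κ * √(V / n)` of an action of probability at most `9 / V` is
not detected by `n` samples. -/
theorem sampleSize_mul_le_one {γ κ V δ π : ℝ} {n : ℕ} (hn : 1 ≤ n) (hγ : 0 ≤ γ) (hκ : 0 ≤ κ)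
    (hγκ : 12 * (γ * κ) ≤ 1) (hV : 0 ≤ V) (hδ : 0 ≤ δ) (hδV : δ ≤ κ * √(V / n)) (hπ : 0 ≤ π)
    (hπV : V * π ≤ 9) : n * (16 * γ ^ 2 * δ ^ 2 * π) ≤ 1 := by
  have hn0 : (0 : ℝ) < n := by exact_mod_cast hn
  have h1 : δ ^ 2 ≤ κ ^ 2 * (V / n) := by
    calc δ ^ 2 ≤ (κ * √(V / n)) ^ 2 := pow_le_pow_left₀ hδ hδV 2
      _ = κ ^ 2 * (V / n) := by rw [mul_pow, Real.sq_sqrt (by positivity)]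
  calc n * (16 * γ ^ 2 * δ ^ 2 * π) ≤ n * (16 * γ ^ 2 * (κ ^ 2 * (V / n)) * π) := by gcongr
    _ = 16 * (γ * κ) ^ 2 * (V * π) := by field_simp
    _ ≤ 16 * (γ * κ) ^ 2 * 9 := by gcongr
    -- Since `16 * 9 = 12 ^ 2`, this is the source of the 12 in the choice of `κ`.
    _ = (12 * (γ * κ)) ^ 2 := by ring
    _ ≤ 1 := pow_le_one₀ (by positivity) hγκ

theorem abs_sub_separated {d : ℕ} {φ : Fin d → ℝ} {S : Finset (Fin d)} {δ : ℝ} (hδ : 0 ≤ δ)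
    {b : Fin d} (hb : b ∈ S) (t : Fin d → ℝ) (v : Fin d → Bool) :
    2 * δ ≤ |t b - cubeVertex φ S δ v b| + |t b - cubeVertex φ S δ (flip b v) b| := by
  rw [← abs_cubeVertex_sub_flip φ hδ v hb, abs_sub_comm (t b)]
  exact abs_sub_le _ _ _

theorem exp_one_le_three : Real.exp 1 ≤ 3 := by linarith [Real.exp_one_lt_d9]

theorem exp_two_le_nine : Real.exp 2 ≤ 9 := by
  rw [show (2 : ℝ) = (2 : ℕ) * 1 by norm_num, Real.exp_nat_mul]
  nlinarith [exp_one_le_three, Real.exp_pos 1]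

theorem exp_three_le : Real.exp 3 ≤ 27 := by
  rw [show (3 : ℝ) = 2 + 1 by norm_num, Real.exp_add]
  nlinarith [exp_one_le_three, exp_two_le_nine, Real.exp_pos 1, Real.exp_pos 2]

/-! ### The class for `p = 1` -/

/-- In `L¹` a gap between two coordinates costs at least its full size, so the ratio is at most `exp
R`, not `exp (2 * R)`. -/
theorem sum_exp_le_of_vecNorm_one {d : ℕ} {R : ℝ} (hR : 0 ≤ R) {x : Fin d → ℝ}
    (hx : vecNorm 1 x ≤ R) (a : Fin d) :
    ∑ b, Real.exp (x b) ≤ Real.exp R * d * Real.exp (x a) := by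
  calc ∑ b, Real.exp (x b) ≤ ∑ _b : Fin d, Real.exp (R + x a) := by
        refine Finset.sum_le_sum fun b _ => Real.exp_le_exp.2 ?_
        by_cases h : b = a
        · rw [h]; linarith
        · have h1 := Finset.sum_le_sum_of_subset_of_nonneg (Finset.subset_univ {b, a})
            fun i _ _ => abs_nonneg (x i)
          rw [Finset.sum_pair h, ← vecNorm_one] at h1
          linarith [le_abs_self (x b), neg_abs_le (x a)]
    _ = _ := by
        rw [Real.exp_add]; simp; ring

/-- The Hellinger separation of the policies on two adjacent vertices. -/
theorem sqrt_softmax_separated {d : ℕ} (hd : 2 ≤ d) {φ : Fin d → ℝ} {S : Finset (Fin d)}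
    {δ : ℝ} (hδ : 0 ≤ δ) (hδ1 : δ ≤ 1) {b : Fin d} (hb : b ∈ S) (v : Fin d → Bool) (z : ℝ) :
    δ ^ 2 / (8 * Real.exp 3 * d) ≤ (√(softmax (cubeVertex φ S δ v - φ) b) - z) ^ 2 +
      (√(softmax (cubeVertex φ S δ (flip b v) - φ) b) - z) ^ 2 := by
  set w := cubeVertex φ S δ v - φ with hw
  set w' := cubeVertex φ S δ (flip b v) - φ with hw'
  -- The weight of the other actions is the same at both vertices. Its lower bound needs a second
  -- action, hence `2 ≤ d`.
  set s := ∑ a ∈ Finset.univ.erase b, Real.exp (w a) with hs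
  have hwabs : ∀ a, |w a| ≤ 1 := fun a => by
    have : w a = if a ∈ S then (if v a then δ else -δ) else 0 := by simp [hw, cubeVertex]
    rw [this]
    split_ifs <;> simp [abs_of_nonneg hδ, hδ1]
  have hsw : softmax w b = Real.exp (w b) / (s + Real.exp (w b)) := by
    rw [softmax, hs, Finset.sum_erase_add _ _ (Finset.mem_univ b)]
  have hsw' : softmax w' b = Real.exp (w' b) / (s + Real.exp (w' b)) := by
    have : s = ∑ a ∈ Finset.univ.erase b, Real.exp (w' a) :=
      Finset.sum_congr rfl fun a ha => by
        rw [hw, hw', Pi.sub_apply, Pi.sub_apply,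
          cubeVertex_flip_of_ne _ _ _ _ (Finset.ne_of_mem_erase ha)]
    rw [softmax, this, Finset.sum_erase_add _ _ (Finset.mem_univ b)]
  have hcard : ((Finset.univ.erase b).card : ℝ) = d - 1 := by
    rw [Finset.card_erase_of_mem (Finset.mem_univ b), Finset.card_univ, Fintype.card_fin,
      Nat.cast_sub (by omega), Nat.cast_one]
  have hd2 : (2 : ℝ) ≤ d := by exact_mod_cast hd
  have hs1 : Real.exp (-1) ≤ s := by
    have := Finset.card_nsmul_le_sum (Finset.univ.erase b) (fun a => Real.exp (w a))
      (Real.exp (-1)) fun a _ => Real.exp_le_exp.2 (abs_le.1 (hwabs a)).1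
    rw [nsmul_eq_mul, hcard] at this
    nlinarith [Real.exp_pos (-1)]
  have hs2 : s + 1 ≤ Real.exp 1 * d := by
    have := Finset.sum_le_card_nsmul (Finset.univ.erase b) (fun a => Real.exp (w a))
      (Real.exp 1) fun a _ => Real.exp_le_exp.2 (abs_le.1 (hwabs a)).2
    rw [nsmul_eq_mul, hcard] at this
    linarith [Real.add_one_le_exp (1 : ℝ)]
  have hkey := sq_sqrt_sub_sqrt_odds_ge hδ hδ1 hs1 hs2
  have hgap : δ ^ 2 / (4 * Real.exp 3 * d) ≤ (√(softmax w b) - √(softmax w' b)) ^ 2 := by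
    rw [hsw, hsw']
    cases h : v b
    · rw [show w b = -δ by simp [hw, cubeVertex, hb, h],
        show w' b = δ by simp [hw', cubeVertex, hb, h, flip]]
      linarith [sub_sq_comm (√(Real.exp δ / (s + Real.exp δ)))
        (√(Real.exp (-δ) / (s + Real.exp (-δ))))]
    · rwa [show w b = δ by simp [hw, cubeVertex, hb, h],
        show w' b = -δ by simp [hw', cubeVertex, hb, h, flip]]
  have hhalf : δ ^ 2 / (8 * Real.exp 3 * d) = δ ^ 2 / (4 * Real.exp 3 * d) / 2 := by
    rw [div_div]; ring_nf
  rw [hhalf]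
  -- The midpoint is the worst `z`: the sum of squares is at least half the squared gap.
  nlinarith [sq_nonneg (√(softmax w b) + √(softmax w' b) - 2 * z)]

theorem minimax_lower_bound_one {γ₀ κ c : ℝ} (hκ0 : 0 < κ) (hκ1 : κ ≤ 1)
    (hγκ : 12 * (γ₀ * κ) ≤ 1) (hc : c = κ ^ 2 / 70000) {d : ℕ} (hd : 2 ≤ d) {R : ℝ} (hR : 1 ≤ R) :
    ∃ π₀ ∈ stdSimplex ℝ (Fin d), ∃ Θ : Set (Fin d → ℝ), IsNearUniformClass 1 R π₀ Θ ∧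
      ∀ θ₁ ∈ Θ, ∀ γ : ℝ, 0 < γ → γ ≤ γ₀ → ∀ n : ℕ, 1 ≤ n →
        ENNReal.ofReal c *
            min ((d : ℝ≥0∞) * (localCoverage 1 π₀ θ₁ R / (n : ℝ≥0∞)) ^ (1 / 2 : ℝ)) 1
          ≤ minimaxRisk n γ π₀ Θ (fun t θs => vecNorm 1 (t - θs)) ∧
        ENNReal.ofReal c * min (localCoverage 1 π₀ θ₁ R / (n : ℝ≥0∞)) (1 / (d : ℝ≥0∞) ^ 2)
          ≤ minimaxRisk n γ π₀ Θ (fun t θs => klDivergence (policy π₀ θs) (policy π₀ t)) := by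
  have : NeZero d := ⟨by omega⟩
  -- Action 0 gets base weight `exp (R - 1)` and the others weight 1. The norm `R - 1` leaves room
  -- for the unit ball.
  set φ : Fin d → ℝ := Pi.single 0 (-(R - 1)) with hφ
  have hφn : vecNorm 1 φ ≤ R - 1 := by
    rw [hφ, vecNorm_single le_rfl, abs_neg, abs_of_nonneg (by linarith)]
  have hπ := softmax_mem_stdSimplex (-φ)
  refine ⟨softmax (-φ), hπ, lpBall 1 φ 1, isNearUniformClass_lpBall le_rfl hφn, ?_⟩
  intro θ₁ hθ₁ γ hγ hγγ n hn
  have hC := localCoverage_le le_rfl hθ₁ (Real.exp_pos R)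
    fun x hx a => sum_exp_le_of_vecNorm_one (by linarith) hx a
  have hn0 : (0 : ℝ) < n := by exact_mod_cast hn
  have hd2 : (2 : ℝ) ≤ d := by exact_mod_cast hd
  have hd0 : (0 : ℝ) < d := by linarith
  set y := √(Real.exp R / n) with hy
  have hy0 : 0 < y := Real.sqrt_pos.2 (by positivity)
  have hysq : y ^ 2 = Real.exp R / n := Real.sq_sqrt (by positivity)
  -- The cap `1 / d` fits a cube in `d - 1` coordinates into the unit `L¹` ball; `κ * y` is the
  -- detection threshold.
  set δ := min (1 / (d : ℝ)) (κ * y) with hδdef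
  have hδ : 0 ≤ δ := le_min (by positivity) (by positivity)
  have hδd : δ ≤ 1 / d := min_le_left _ _
  have hδ1 : δ ≤ 1 := hδd.trans (by rw [div_le_one hd0]; linarith)
  set S : Finset (Fin d) := Finset.univ.erase 0 with hS
  have hcard : (S.card : ℝ) = d - 1 := by
    rw [hS, Finset.card_erase_of_mem (Finset.mem_univ _), Finset.card_univ, Fintype.card_fin,
      Nat.cast_sub (by omega), Nat.cast_one]
  have hΘ : ∀ v, cubeVertex φ S δ v ∈ lpBall 1 φ 1 := cubeVertex_mem_lpBall le_rfl φ hδ (by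
    rw [hcard]
    calc ((d : ℝ) - 1) * δ ≤ d * (1 / d) := by gcongr; linarith
      _ = 1 := by field_simp)
  have hrare : ∀ b ∈ S, Real.exp R * softmax (-φ) b ≤ 9 := fun b hb => by
    have hb0 : b ≠ 0 := Finset.ne_of_mem_erase hb
    have h1 : Real.exp (R - 1) ≤ ∑ a, Real.exp ((-φ) a) := by
      have := Finset.single_le_sum (f := fun a => Real.exp ((-φ) a))
        (fun a _ => (Real.exp_pos _).le) (Finset.mem_univ (0 : Fin d))
      simpa [hφ] using this
    have h2 : Real.exp ((-φ) b) = 1 := by simp [hφ, hb0]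
    rw [softmax, h2, mul_one_div, div_le_iff₀ (sum_exp_pos _)]
    have h3 : Real.exp R = Real.exp 1 * Real.exp (R - 1) := by rw [← Real.exp_add]; ring_nf
    rw [h3]
    gcongr
    linarith [exp_one_le_three]
  have hbudget : ∀ b ∈ S, n * (16 * γ ^ 2 * δ ^ 2 * softmax (-φ) b) ≤ 1 := fun b hb =>
    sampleSize_mul_le_one hn hγ.le hκ0.le
      ((mul_le_mul_of_nonneg_left (mul_le_mul_of_nonneg_right hγγ hκ0.le) (by norm_num)).trans hγκ)
      (Real.exp_pos R).le hδ (min_le_right _ _) (softmax_pos _ _).le (hrare b hb)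
  have hc0 : 0 ≤ c := by rw [hc]; positivity
  have hcκ : c ≤ κ / 70000 := by rw [hc]; gcongr; nlinarith
  constructor
  · refine le_trans ?_ (assouad_le_minimaxRisk hπ (Δ := 2 * δ) hδ hγ.le (by positivity) hbudget
      (fun b t v => |t b - cubeVertex φ S δ v b|) (fun _ _ _ => abs_nonneg _)
      (fun b hb t v => abs_sub_separated hδ hb t v) (fun t v => ?_) hΘ)
    · rw [← ENNReal.ofReal_natCast d]
      refine ofReal_mul_min_sqrt_le hn hd0.le hc0 (by positivity) hC ?_
      have hroot : √(Real.exp 2 * Real.exp R / n) ≤ 3 * y := by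
        rw [Real.sqrt_le_left (by positivity), mul_pow, hysq, mul_div_assoc]
        gcongr
        linarith [exp_two_le_nine]
      rw [hcard]
      have hr : d * δ / 16 ≤ ((d : ℝ) - 1) * (2 * δ) / 16 := by nlinarith
      refine le_trans ?_ hr
      rcases min_choice (1 / (d : ℝ)) (κ * y) with h | h
      · calc c * min (d * √(Real.exp 2 * Real.exp R / n)) 1 ≤ c * 1 := by
              gcongr; exact min_le_right _ _
          _ ≤ 1 / 16 := by linarith
          _ = d * δ / 16 := by rw [hδdef, h]; field_simp
      · calc c * min (d * √(Real.exp 2 * Real.exp R / n)) 1 ≤ κ / 70000 * (d * (3 * y)) := by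
              gcongr; exact (min_le_left _ _).trans (by gcongr)
          _ ≤ d * δ / 16 := by
              rw [hδdef, h]
              nlinarith [mul_pos hκ0 (mul_pos hd0 hy0)]
    · rw [vecNorm_one]
      exact Finset.sum_le_sum_of_subset_of_nonneg (Finset.subset_univ _) fun i _ _ => abs_nonneg _
  · refine le_trans ?_ (assouad_le_minimaxRisk hπ (Δ := δ ^ 2 / (8 * Real.exp 3 * d)) hδ hγ.le
      (by positivity) hbudget
      (fun b t v => (√(softmax (cubeVertex φ S δ v - φ) b) - √(softmax (t - φ) b)) ^ 2)
      (fun _ _ _ => sq_nonneg _) (fun b hb t v => sqrt_softmax_separated hd hδ hδ1 hb v _)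
      (fun t v => ?_) hΘ)
    · refine ofReal_mul_min_le hn (by omega) hc0 hC ?_
      rw [hcard]
      -- Here `6912 = 2 * 16 * 8 * 27`, from `d - 1 ≥ d / 2`, Assouad's 16, and `8 * exp 3` with
      -- `exp 3 ≤ 27`. Together with `exp 2 ≤ 9` this needs `9 * 6912 = 62208 ≤ 70000`.
      have hr : δ ^ 2 / 6912 ≤ ((d : ℝ) - 1) * (δ ^ 2 / (8 * Real.exp 3 * d)) / 16 := by
        calc δ ^ 2 / 6912 ≤ δ ^ 2 / (256 * Real.exp 3) := by
              gcongr; linarith [exp_three_le]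
          _ = (d / 2) * (δ ^ 2 / (8 * Real.exp 3 * d)) / 16 := by field_simp; ring
          _ ≤ _ := by gcongr; linarith
      refine le_trans ?_ hr
      rw [mul_div_assoc, ← hysq]
      rcases min_choice (1 / (d : ℝ)) (κ * y) with h | h
      · calc c * min (Real.exp 2 * y ^ 2) (1 / (d : ℝ) ^ 2) ≤ 1 / 6912 * (1 / (d : ℝ) ^ 2) := by
              gcongr
              · linarith
              · exact min_le_right _ _
          _ = δ ^ 2 / 6912 := by rw [hδdef, h]; ring
      · calc c * min (Real.exp 2 * y ^ 2) (1 / (d : ℝ) ^ 2) ≤ c * (9 * y ^ 2) := by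
              gcongr
              exact (min_le_left _ _).trans (by gcongr; exact exp_two_le_nine)
          _ ≤ δ ^ 2 / 6912 := by
              rw [hδdef, h, hc]
              nlinarith [mul_pos (pow_pos hκ0 2) (pow_pos hy0 2)]
    · rw [policy_softmax, policy_softmax]
      exact (Finset.sum_le_sum_of_subset_of_nonneg (Finset.subset_univ _)
        fun i _ _ => sq_nonneg _).trans (hellinger_le_klDivergence (softmax_pos _) (softmax_pos _)
          (sum_softmax _) (sum_softmax _))

/-- For `d = 1` no action is left beside the heavy one, but the coverage is 0 and both bounds are
trivial. -/
theorem minimax_lower_bound_one_of_subsingleton (c : ℝ) {R : ℝ} (hR : 1 ≤ R) :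
    ∃ π₀ ∈ stdSimplex ℝ (Fin 1), ∃ Θ : Set (Fin 1 → ℝ), IsNearUniformClass 1 R π₀ Θ ∧
      ∀ θ₁ ∈ Θ, ∀ γ : ℝ, 0 < γ → ∀ n : ℕ,
        ENNReal.ofReal c *
            min (((1 : ℕ) : ℝ≥0∞) * (localCoverage 1 π₀ θ₁ R / (n : ℝ≥0∞)) ^ (1 / 2 : ℝ)) 1
          ≤ minimaxRisk n γ π₀ Θ (fun t θs => vecNorm 1 (t - θs)) ∧
        ENNReal.ofReal c *
            min (localCoverage 1 π₀ θ₁ R / (n : ℝ≥0∞)) (1 / ((1 : ℕ) : ℝ≥0∞) ^ 2)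
          ≤ minimaxRisk n γ π₀ Θ (fun t θs => klDivergence (policy π₀ θs) (policy π₀ t)) := by
  refine ⟨softmax (-0), softmax_mem_stdSimplex _, lpBall 1 0 1,
    isNearUniformClass_lpBall le_rfl (by rw [vecNorm_zero le_rfl]; linarith), ?_⟩
  intro θ₁ _ γ _ n
  rw [localCoverage_eq_zero]
  simp

/-! ### The class for general `p` -/

/-- A nearly optimal tilt in the ball of radius `R`, with the action whose likelihood ratio it
makes large. -/
theorem exists_nearly_optimal_tilt {d : ℕ} [NeZero d] {p : ℝ≥0∞} (hp : 1 ≤ p) {R : ℝ}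
    (hR : 0 ≤ R) :
    ∃ (x : Fin d → ℝ) (a : Fin d) (M : ℝ), vecNorm p x ≤ R ∧ 0 < M ∧
      M * d * Real.exp (x a) = ∑ b, Real.exp (x b) ∧
      ∀ x' : Fin d → ℝ, vecNorm p x' ≤ R → ∀ a',
        ∑ b, Real.exp (x' b) ≤ 2 * M * d * Real.exp (x' a') := by
  set g : {x : Fin d → ℝ // vecNorm p x ≤ R} × Fin d → ℝ :=
    fun z => (∑ b, Real.exp (z.1.1 b)) / (d * Real.exp (z.1.1 z.2)) with hg
  have hd0 : (0 : ℝ) < d := by exact_mod_cast Nat.pos_of_ne_zero (NeZero.ne d)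
  have hpos : ∀ z, 0 < g z := fun z => div_pos (sum_exp_pos _) (by positivity)
  have hbdd : BddAbove (Set.range g) := by
    refine ⟨Real.exp (2 * R), ?_⟩
    rintro _ ⟨⟨⟨x, hx⟩, a⟩, rfl⟩
    have hxa : ∀ b, |x b| ≤ R := fun b => (abs_le_vecNorm hp x b).trans hx
    rw [hg, div_le_iff₀ (by positivity)]
    calc ∑ b, Real.exp (x b) ≤ ∑ _b : Fin d, Real.exp (2 * R + x a) :=
          Finset.sum_le_sum fun b _ => Real.exp_le_exp.2 (by
            linarith [(abs_le.1 (hxa b)).2, (abs_le.1 (hxa a)).1])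
      _ = _ := by rw [Real.exp_add]; simp; ring
  set z₀ : {x : Fin d → ℝ // vecNorm p x ≤ R} × Fin d :=
    ⟨⟨0, by rw [vecNorm_zero hp]; exact hR⟩, 0⟩
  have hsup : 0 < sSup (Set.range g) := (hpos z₀).trans_le (le_csSup hbdd ⟨z₀, rfl⟩)
  -- Coming within a factor 2 of the supremum avoids showing that it is attained.
  obtain ⟨_, ⟨⟨⟨x, hx⟩, a⟩, rfl⟩, hlt⟩ :=
    exists_lt_of_lt_csSup ⟨_, Set.mem_range_self z₀⟩ (half_lt_self hsup)
  refine ⟨x, a, g ⟨⟨x, hx⟩, a⟩, hx, hpos _, ?_, fun x' hx' a' => ?_⟩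
  · rw [hg]; field_simp
  · have h1 : g ⟨⟨x', hx'⟩, a'⟩ ≤ 2 * g ⟨⟨x, hx⟩, a⟩ :=
      (le_csSup hbdd ⟨_, rfl⟩).trans (by linarith)
    have h2 : ∑ b, Real.exp (x' b) = g ⟨⟨x', hx'⟩, a'⟩ * (d * Real.exp (x' a')) := by
      rw [hg]; field_simp
    rw [h2, mul_assoc (2 * _)]
    gcongr

/-- The dimension enters through the rarity of one action: `softmax x` gives `a` probability `1 / (d
* M)`, so its threshold is already of order `√(d * M / n)`. -/
theorem minimax_lower_bound {γ₀ κ c : ℝ} (hκ0 : 0 < κ) (hκ1 : κ ≤ 1)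
    (hγκ : 12 * (γ₀ * κ) ≤ 1) (hc : c = κ ^ 2 / 70000) {d : ℕ} (hd : 1 ≤ d) {R : ℝ} (hR : 1 ≤ R)
    {p : ℝ≥0∞} (hp : 1 ≤ p) :
    ∃ π₀ ∈ stdSimplex ℝ (Fin d), ∃ Θ : Set (Fin d → ℝ), IsNearUniformClass p R π₀ Θ ∧
      ∀ θ₁ ∈ Θ, ∀ γ : ℝ, 0 < γ → γ ≤ γ₀ → ∀ n : ℕ, 1 ≤ n →
        ENNReal.ofReal c *
            min (((d : ℝ≥0∞) * localCoverage p π₀ θ₁ R / (n : ℝ≥0∞)) ^ (1 / 2 : ℝ)) 1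
          ≤ minimaxRisk n γ π₀ Θ (fun t θs => vecNorm p (t - θs)) := by
  have : NeZero d := ⟨by omega⟩
  have hd0 : (0 : ℝ) < d := by exact_mod_cast hd
  have hR0 : 0 < R := by linarith
  obtain ⟨x, a, M, hx, hM, hxM, hmax⟩ :=
    exists_nearly_optimal_tilt (d := d) hp hR0.le
  -- Shrinking `x` by `τ` brings its norm to at most `R - 1` and moves each coordinate by at most 1,
  -- so the probability of `a` grows by at most `exp 2`.
  set τ := 1 - 1 / R with hτ
  have hτ0 : 0 ≤ τ := by rw [hτ, sub_nonneg, div_le_one hR0]; exact hR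
  set φ : Fin d → ℝ := (-τ) • x with hφ
  have hφn : vecNorm p φ ≤ R - 1 := by
    rw [hφ, vecNorm_smul hp, abs_neg, abs_of_nonneg hτ0]
    calc τ * vecNorm p x ≤ τ * R := by gcongr
      _ = R - 1 := by rw [hτ]; field_simp
  have hπ := softmax_mem_stdSimplex (-φ)
  refine ⟨softmax (-φ), hπ, lpBall p φ 1, isNearUniformClass_lpBall hp hφn, ?_⟩
  intro θ₁ hθ₁ γ hγ hγγ n hn
  have hC := localCoverage_le hp hθ₁ (by positivity : 0 < 2 * M) hmax
  have hn0 : (0 : ℝ) < n := by exact_mod_cast hn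
  set V := d * M with hV
  have hV0 : 0 < V := by positivity
  set y := √(V / n) with hy
  have hy0 : 0 < y := Real.sqrt_pos.2 (by positivity)
  have hysq : y ^ 2 = V / n := Real.sq_sqrt (by positivity)
  set δ := min 1 (κ * y) with hδdef
  have hδ : 0 ≤ δ := le_min zero_le_one (by positivity)
  have hrare : V * softmax (-φ) a ≤ 9 := by
    have hshift : ∀ b, |x b - (-φ) b| ≤ 1 := fun b => by
      have e : x b - (-φ) b = x b / R := by simp [hφ, hτ]; ring
      rw [e, abs_div, abs_of_pos hR0, div_le_one hR0]
      exact (abs_le_vecNorm hp x b).trans hx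
    have h1 : Real.exp ((-φ) a) ≤ Real.exp 1 * Real.exp (x a) := by
      rw [← Real.exp_add]
      exact Real.exp_le_exp.2 (by linarith [(abs_le.1 (hshift a)).1])
    have h2 : ∑ b, Real.exp (x b) ≤ Real.exp 1 * ∑ b, Real.exp ((-φ) b) := by
      rw [Finset.mul_sum]
      refine Finset.sum_le_sum fun b _ => ?_
      rw [← Real.exp_add]
      exact Real.exp_le_exp.2 (by linarith [(abs_le.1 (hshift b)).2])
    rw [softmax, ← mul_div_assoc, div_le_iff₀ (sum_exp_pos _)]
    calc V * Real.exp ((-φ) a) ≤ V * (Real.exp 1 * Real.exp (x a)) := by gcongr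
      _ = Real.exp 1 * (M * d * Real.exp (x a)) := by rw [hV]; ring
      _ ≤ Real.exp 1 * (Real.exp 1 * ∑ b, Real.exp ((-φ) b)) := by rw [hxM]; gcongr
      _ = Real.exp 2 * ∑ b, Real.exp ((-φ) b) := by
          rw [← mul_assoc, ← Real.exp_add]; norm_num
      _ ≤ _ := by
          have := (sum_exp_pos (-φ)).le
          gcongr
          exact exp_two_le_nine
  have hbudget : ∀ b ∈ ({a} : Finset (Fin d)),
      n * (16 * γ ^ 2 * δ ^ 2 * softmax (-φ) b) ≤ 1 := fun b hb => by
    rw [Finset.mem_singleton.1 hb]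
    exact sampleSize_mul_le_one hn hγ.le hκ0.le
      ((mul_le_mul_of_nonneg_left (mul_le_mul_of_nonneg_right hγγ hκ0.le) (by norm_num)).trans hγκ)
      hV0.le hδ (min_le_right _ _) (softmax_pos _ _).le hrare
  have hΘ : ∀ v, cubeVertex φ {a} δ v ∈ lpBall p φ 1 :=
    cubeVertex_mem_lpBall hp φ hδ (by simp [hδdef])
  refine le_trans ?_ (assouad_le_minimaxRisk hπ (Δ := 2 * δ) hδ hγ.le (by positivity) hbudget
    (fun b t v => |t b - cubeVertex φ {a} δ v b|) (fun _ _ _ => abs_nonneg _)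
    (fun b hb t v => abs_sub_separated hδ hb t v) (fun t v => ?_) hΘ)
  · have hc0 : 0 ≤ c := by rw [hc]; positivity
    have hcκ : c ≤ κ / 70000 := by rw [hc]; gcongr; nlinarith
    have hdC : (d : ℝ≥0∞) * localCoverage p (softmax (-φ)) θ₁ R ≤
        ENNReal.ofReal (d * (Real.exp 2 * (2 * M))) := by
      rw [ENNReal.ofReal_mul hd0.le, ENNReal.ofReal_natCast]
      gcongr
    -- `2 * exp 2 ≤ 18 ≤ 5 ^ 2`.
    have hroot : √(d * (Real.exp 2 * (2 * M)) / n) ≤ 5 * y := by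
      rw [Real.sqrt_le_left (by positivity), mul_pow, hysq, ← mul_div_assoc]
      refine div_le_div_of_nonneg_right ?_ hn0.le
      rw [hV]
      nlinarith [exp_two_le_nine, mul_pos hd0 hM]
    have := ofReal_mul_min_sqrt_le (r := ({a} : Finset (Fin d)).card * (2 * δ) / 16) hn
      zero_le_one hc0 (by positivity) hdC (by
        rw [Finset.card_singleton, Nat.cast_one, one_mul, one_mul]
        rcases min_choice 1 (κ * y) with h | h
        · calc c * min √(d * (Real.exp 2 * (2 * M)) / n) 1 ≤ c * 1 := by
                gcongr; exact min_le_right _ _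
            _ ≤ 2 * δ / 16 := by rw [hδdef, h]; linarith
        · calc c * min √(d * (Real.exp 2 * (2 * M)) / n) 1 ≤ κ / 70000 * (5 * y) := by
                gcongr; exact (min_le_left _ _).trans hroot
            _ ≤ 2 * δ / 16 := by
                rw [hδdef, h]
                nlinarith [mul_pos hκ0 hy0])
    simpa using this
  · rw [Finset.sum_singleton]
    exact abs_le_vecNorm hp (t - cubeVertex φ {a} δ v) a

end OfflinePref

theorem mainTheorem2 (γ₀ : ℝ) (hγ₀ : 0 < γ₀) :
    ∃ c : ℝ, 0 < c ∧ ∀ (d : ℕ) (R : ℝ), 1 ≤ d → 1 ≤ R →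
      (∃ π₀ ∈ stdSimplex ℝ (Fin d), ∃ Θ : Set (Fin d → ℝ),
        OfflinePref.IsNearUniformClass 1 R π₀ Θ ∧
        ∀ θ₁ ∈ Θ, ∀ γ : ℝ, 0 < γ → γ ≤ γ₀ → ∀ n : ℕ, 1 ≤ n →
          ENNReal.ofReal c *
              min ((d : ℝ≥0∞) * (OfflinePref.localCoverage 1 π₀ θ₁ R / (n : ℝ≥0∞)) ^ (1 / 2 : ℝ)) 1
            ≤ OfflinePref.minimaxRisk n γ π₀ Θ (fun t θs => OfflinePref.vecNorm 1 (t - θs)) ∧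
          ENNReal.ofReal c *
              min (OfflinePref.localCoverage 1 π₀ θ₁ R / (n : ℝ≥0∞)) (1 / (d : ℝ≥0∞) ^ 2)
            ≤ OfflinePref.minimaxRisk n γ π₀ Θ (fun t θs => OfflinePref.klDivergence
                (OfflinePref.policy π₀ θs) (OfflinePref.policy π₀ t))) ∧
      (∀ p : ℝ≥0∞, 1 < p →
        ∃ π₀ ∈ stdSimplex ℝ (Fin d), ∃ Θ : Set (Fin d → ℝ),
          OfflinePref.IsNearUniformClass p R π₀ Θ ∧
          ∀ θ₁ ∈ Θ, ∀ γ : ℝ, 0 < γ → γ ≤ γ₀ → ∀ n : ℕ, 1 ≤ n →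
            ENNReal.ofReal c *
                min (((d : ℝ≥0∞) * OfflinePref.localCoverage p π₀ θ₁ R / (n : ℝ≥0∞)) ^ (1 / 2 : ℝ)) 1
              ≤ OfflinePref.minimaxRisk n γ π₀ Θ (fun t θs => OfflinePref.vecNorm p (t - θs))) := by
  have h0 : γ₀ + 1 ≠ 0 := by positivity
  -- The `+ 1` keeps `κ ≤ 1` for small `γ₀`.
  set κ := 1 / (12 * (γ₀ + 1)) with hκ
  have hκ0 : 0 < κ := by positivity
  have hκ1 : κ ≤ 1 := by
    rw [hκ, div_le_one (by positivity)]
    linarith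
  have hγκ : 12 * (γ₀ * κ) ≤ 1 := by
    have : 12 * (γ₀ * κ) = γ₀ / (γ₀ + 1) := by rw [hκ]; field_simp
    rw [this, div_le_one (by positivity)]
    linarith
  refine ⟨κ ^ 2 / 70000, by positivity, fun d R hd hR => ⟨?_, fun p hp =>
    OfflinePref.minimax_lower_bound hκ0 hκ1 hγκ rfl hd hR hp.le⟩⟩
  obtain rfl | hd2 := hd.eq_or_lt
  · obtain ⟨π₀, hπ, Θ, hΘ, h⟩ :=
      OfflinePref.minimax_lower_bound_one_of_subsingleton (κ ^ 2 / 70000) hR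
    exact ⟨π₀, hπ, Θ, hΘ, fun θ₁ hθ₁ γ hγ _ n _ => h θ₁ hθ₁ γ hγ n⟩
  · exact OfflinePref.minimax_lower_bound_one hκ0 hκ1 hγκ rfl hd2 hR
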